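/- Let a finite-horizon Markov decision process be given by measurable state and action spaces $\mathcal S,\mathcal A$, transition probabilities $\mathbb P(S_{t+1}\in\cdot\mid S_t,A_t)$, an initial distribution $\mu$ of $S_0$, a measurable reward $r:\mathcal S\times\mathcal A\to\mathbb R$ and a horizon $T\in\{0,1,2,\dots\}$. Let $\mathcal S_{\rm safe}\subseteq\mathcal S$ be measurable and $\delta\in[0,1]$. Policies are stochastic kernels $\pi(\cdot\mid s)$ from $\mathcal S$ to $\mathcal A$; let $\pi_\theta$, $\theta\in\mathbb R^d$, be a parametrized family of policies that is universal: every stochastic kernel from $\mathcal S$ to $\mathcal A$ equals $\pi_\theta$ for some $\theta$. Put $$V(\theta)=\mathbb E\Big[\sum_{t=0}^T r(S_t,A_t)\,\Big|\,\pi_\theta\Big],\qquad p(\theta)=\mathbb P\Big(\bigcap_{t=0}^T\{S_t\in\mathcal S_{\rm safe}\}\,\Big|\,\pi_\theta\Big),\qquad V_c(\theta)=\mathbb E\Big[\frac1{T+1}\sum_{t=0}^T\mathbb 1(S_t\in\mathcal S_{\rm safe})\,\Big|\,\pi_\theta\Big],$$ where $\sum_{t=0}^T r(S_t,A_t)$ is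 assumed integrable under every $\pi_\theta$. Consider the probabilistic-constrained problem with its dual function and its dual optimum, $$P^\star=\sup_{\theta:\,p(\theta)\ge 1-\delta}V(\theta),\qquad d(\lambda)=\sup_{\theta\in\mathbb R^d}\ V(\theta)+\lambda\big(p(\theta)-(1-\delta)\big),\qquad D^\star=\inf_{\lambda\ge0}d(\lambda),$$ and the dual function of the cumulative-constrained problem (maximize $V(\theta)$ subject to $V_c(\theta)\ge 1-\frac{\delta}{T+1}$), $$\hat d(\lambda)=\max_{\theta\in\mathbb R^d}\ V(\theta)+\lambda\Big(V_c(\theta)-\Big(1-\frac{\delta}{T+1}\Big)\Big),\qquad \lambda\ge0,$$ where the maximum is assumed to be attained for every $\lambda\ge0$. Let $\hat\lambda^\star\in\arg\min_{\lambda\ge0}\hat d(\lambda)$. Then $$P^\star\ \le\ D^\star\ \le\ P^\star+\hat\lambda^\star\,\delta\,\frac{T}{T+1}.$$ -/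

import Mathlib

open MeasureTheory ProbabilityTheory

noncomputable section

namespace SafeRL

/-- A finite-horizon Markov decision process on measurable state and action spaces: transition
probabilities, initial state distribution, measurable reward and time horizon. -/
structure MDP (S A : Type*) [MeasurableSpace S] [MeasurableSpace A] where
  transition : Kernel (S × A) S
  isMarkovKernel_transition : IsMarkovKernel transition
  init : Measure S
  isProbabilityMeasure_init : IsProbabilityMeasure init
  reward : S × A → ℝ
  measurable_reward : Measurable reward
  horizon : ℕ

/-- A (stationary, randomized) policy: a stochastic kernel with source the state space and
target the action space. -/
structure Policy (S A : Type*) [MeasurableSpace S] [MeasurableSpace A] where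
  kernel : Kernel S A
  isMarkovKernel_kernel : IsMarkovKernel kernel

attribute [instance] MDP.isMarkovKernel_transition MDP.isProbabilityMeasure_init
  Policy.isMarkovKernel_kernel

namespace MDP

variable {S A : Type*} [MeasurableSpace S] [MeasurableSpace A]

/-- The conditional law of the pair `(S_{n+1}, A_{n+1})` given the history up to time `n`:
`S_{n+1}` is drawn from the transition probability at `(S_n, A_n)`, and then `A_{n+1}` from the
policy at `S_{n+1}`. -/
def stepKernel (M : MDP S A) (p : Policy S A) (n : ℕ) :
    Kernel ((i : Finset.Iic n) → S × A) (S × A) :=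
  (M.transition.compProd (p.kernel.prodMkLeft (S × A))).comap
    (fun h => h ⟨n, Finset.mem_Iic.2 le_rfl⟩) (measurable_pi_apply _)

instance (M : MDP S A) (p : Policy S A) (n : ℕ) : IsMarkovKernel (M.stepKernel p n) := by
  unfold stepKernel
  infer_instance

/-- The law of the state-action trajectory `(S_0, A_0), (S_1, A_1), …` under a policy, with `S_0`
drawn from the initial distribution and `A_0` from the policy at `S_0`. Only the coordinates up to
the horizon are used below. -/
def law (M : MDP S A) (p : Policy S A) : Measure (ℕ → S × A) :=
  Kernel.trajMeasure (X := fun _ => S × A) (M.init.compProd p.kernel) (M.stepKernel p)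

/-- The cumulative reward `∑_{t=0}^T r(S_t, A_t)` of a trajectory. -/
def totalReward (M : MDP S A) (w : ℕ → S × A) : ℝ :=
  ∑ t ∈ Finset.range (M.horizon + 1), M.reward (w t)

/-- The value `E[∑_{t=0}^T r(S_t, A_t)]` of a policy. -/
def value (M : MDP S A) (p : Policy S A) : ℝ :=
  ∫ w, M.totalReward w ∂(M.law p)

/-- The probability `P(⋂_{t=0}^T {S_t ∈ safe})` under a policy. -/
def safeProb (M : MDP S A) (safe : Set S) (p : Policy S A) : ℝ :=
  (M.law p).real (⋂ t ∈ Finset.range (M.horizon + 1), {w | (w t).1 ∈ safe})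

/-- The cumulative safety `E[1/(T+1) ∑_{t=0}^T 1(S_t ∈ safe)]` under a policy. -/
def cumSafe (M : MDP S A) (safe : Set S) (p : Policy S A) : ℝ :=
  ∫ w, 1 / ((M.horizon : ℝ) + 1) *
    ∑ t ∈ Finset.range (M.horizon + 1), safe.indicator (fun _ => (1 : ℝ)) (w t).1 ∂(M.law p)

/-! Throughout, `pol θ` is the policy with parameter `θ ∈ ℝ^d`. Optimal values are suprema and
infima in the extended reals. -/

variable {d : ℕ}

/-- Optimal value `P*` of the probabilistic-constrained problem:
maximize the value subject to `P(⋂_{t=0}^T {S_t ∈ safe}) ≥ 1 - δ`. -/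
def primalOpt (M : MDP S A) (safe : Set S) (δ : ℝ)
    (pol : EuclideanSpace ℝ (Fin d) → Policy S A) : EReal :=
  ⨆ θ ∈ {θ | 1 - δ ≤ M.safeProb safe (pol θ)}, (M.value (pol θ) : EReal)

/-- Dual function `d(lam)` of the probabilistic-constrained problem. -/
def dualFun (M : MDP S A) (safe : Set S) (δ : ℝ)
    (pol : EuclideanSpace ℝ (Fin d) → Policy S A) (lam : ℝ) : EReal :=
  ⨆ θ, ((M.value (pol θ) + lam * (M.safeProb safe (pol θ) - (1 - δ)) : ℝ) : EReal)

/-- Dual optimum `D*` of the probabilistic-constrained problem. -/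
def dualOpt (M : MDP S A) (safe : Set S) (δ : ℝ)
    (pol : EuclideanSpace ℝ (Fin d) → Policy S A) : EReal :=
  ⨅ lam ∈ Set.Ici (0 : ℝ), M.dualFun safe δ pol lam

/-- Lagrangian of the cumulative-constrained problem: maximize the value subject to
`E[1/(T+1) ∑_{t=0}^T 1(S_t ∈ safe)] ≥ 1 - δ/(T+1)`. -/
def cumLagrangian (M : MDP S A) (safe : Set S) (δ : ℝ)
    (pol : EuclideanSpace ℝ (Fin d) → Policy S A) (lam : ℝ)
    (θ : EuclideanSpace ℝ (Fin d)) : ℝ :=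
  M.value (pol θ) + lam * (M.cumSafe safe (pol θ) - (1 - δ / ((M.horizon : ℝ) + 1)))

/-- Dual function of the cumulative-constrained problem. -/
def cumDualFun (M : MDP S A) (safe : Set S) (δ : ℝ)
    (pol : EuclideanSpace ℝ (Fin d) → Policy S A) (lam : ℝ) : EReal :=
  ⨆ θ, (M.cumLagrangian safe δ pol lam θ : EReal)

end MDP

end SafeRL

end

/-! Write m for the initial probability of `safe`, which is the same under every policy. Then (T+1)
V_c is m plus the sum of P(S_t ∈ safe) over 1 ≤ t ≤ T, and each summand lies between p and 1, so m +
T p ≤ (T+1) V_c ≤ m + T. The lower bound compares the two Lagrangians at multipliers λ̂ T/(T+1) and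
λ̂ (`lagrangian_scaled_le`), and so bounds D* by d̂(λ̂) plus an explicit term. The upper bound caps
the slack of the cumulative constraint, so Lagrangian maximizers at multipliers just above λ̂, which
are feasible by minimality of λ̂ and the union bound, have value at least d̂(λ̂) minus an explicit
term (`exists_feasible_cumLagrangian_le`). In the difference m cancels and λ̂ δ T/(T+1) remains. -/

namespace ProbabilityTheory.Kernel

open Finset Preorder

/-- The marginal at time `0` of the law of a trajectory is its initial distribution. -/
theorem map_eval_zero_trajMeasure {X : ℕ → Type*} [∀ n, MeasurableSpace (X n)]
    (μ₀ : Measure (X 0)) (κ : (n : ℕ) → Kernel ((i : Iic n) → X i) (X (n + 1)))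
    [∀ n, IsMarkovKernel (κ n)] :
    (trajMeasure μ₀ κ).map (fun x => x 0) = μ₀ := by
  have hf : (fun x : (n : ℕ) → X n => x 0) =
      (fun x : (i : Iic 0) → X i => x ⟨0, mem_Iic.2 le_rfl⟩) ∘ frestrictLe 0 := rfl
  -- Up to time 0 no transition has been made: the partial trajectory kernel from 0 to 0 is the
  -- identity.
  rw [hf, ← Measure.map_map (by fun_prop) (by fun_prop), trajMeasure,
    Measure.map_comp _ _ (by fun_prop), traj_map_frestrictLe, partialTraj_self, Measure.id_comp]
  have hg : Measurable fun x : (i : Iic 0) → X i => x ⟨0, mem_Iic.2 le_rfl⟩ := by fun_prop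
  exact (Measure.map_map (μ := μ₀) hg
    (MeasurableEquiv.piUnique fun i : Iic 0 => X i).symm.measurable).trans Measure.map_id

end ProbabilityTheory.Kernel

namespace SafeRL.MDP

variable {S A : Type*} [MeasurableSpace S] [MeasurableSpace A]

instance (M : MDP S A) (p : Policy S A) : IsProbabilityMeasure (M.law p) := by
  unfold law
  infer_instance

theorem measurableSet_safe_at {safe : Set S} (hsafe : MeasurableSet safe) (t : ℕ) :
    MeasurableSet {w : ℕ → S × A | (w t).1 ∈ safe} :=
  (measurable_fst.comp (measurable_pi_apply t)) hsafe

/-- The law of the initial state does not depend on the policy. -/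
theorem law_real_safe_zero (M : MDP S A) (p : Policy S A) {safe : Set S}
    (hsafe : MeasurableSet safe) :
    (M.law p).real {w | (w 0).1 ∈ safe} = M.init.real safe := by
  have h0 : (M.law p).map (fun w => w 0) = M.init.compProd p.kernel :=
    Kernel.map_eval_zero_trajMeasure (X := fun _ => S × A) _ _
  have h1 : (M.law p).map (fun w => (w 0).1) = M.init := by
    have : (fun w : ℕ → S × A => (w 0).1) = Prod.fst ∘ fun w => w 0 := rfl
    rw [this, ← Measure.map_map measurable_fst (measurable_pi_apply 0), h0]
    exact Measure.fst_compProd _ _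
  rw [← h1]
  exact (map_measureReal_apply (measurable_fst.comp (measurable_pi_apply 0)) hsafe).symm

theorem succ_mul_cumSafe (M : MDP S A) (p : Policy S A) {safe : Set S}
    (hsafe : MeasurableSet safe) :
    ((M.horizon : ℝ) + 1) * M.cumSafe safe p =
      ∑ t ∈ Finset.range (M.horizon + 1), (M.law p).real {w | (w t).1 ∈ safe} := by
  have hind : ∀ (t : ℕ), (fun w : ℕ → S × A => safe.indicator (fun _ => (1 : ℝ)) (w t).1) =
      {w : ℕ → S × A | (w t).1 ∈ safe}.indicator (fun _ => 1) := fun t => rfl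
  have hT : ((M.horizon : ℝ) + 1) ≠ 0 := by positivity
  rw [cumSafe, integral_const_mul, ← mul_assoc, mul_one_div_cancel hT, one_mul,
    integral_finsetSum]
  · refine Finset.sum_congr rfl fun t _ => ?_
    rw [hind, integral_indicator_const _ (measurableSet_safe_at hsafe t), smul_eq_mul, mul_one]
  · intro t _
    rw [hind]
    exact (integrable_const _).indicator (measurableSet_safe_at hsafe t)

theorem safeProb_le_law_real (M : MDP S A) (safe : Set S) (p : Policy S A) {t : ℕ}
    (ht : t ∈ Finset.range (M.horizon + 1)) :
    M.safeProb safe p ≤ (M.law p).real {w | (w t).1 ∈ safe} :=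
  measureReal_mono (Set.biInter_subset_of_mem ht)

/-- Union bound: the probability of ever being unsafe is at most the expected time spent in unsafe
states. -/
theorem one_sub_safeProb_le (M : MDP S A) (p : Policy S A) {safe : Set S}
    (hsafe : MeasurableSet safe) :
    1 - M.safeProb safe p ≤ ((M.horizon : ℝ) + 1) * (1 - M.cumSafe safe p) := by
  have hm : MeasurableSet (⋂ t ∈ Finset.range (M.horizon + 1), {w : ℕ → S × A | (w t).1 ∈ safe}) :=
    Finset.measurableSet_biInter _ fun t _ => measurableSet_safe_at hsafe t
  rw [mul_sub, succ_mul_cumSafe M p hsafe, safeProb, ← probReal_compl_eq_one_sub hm]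
  simp only [Set.compl_iInter]
  refine (measureReal_biUnion_finset_le _ _).trans (le_of_eq ?_)
  simp_rw [probReal_compl_eq_one_sub (measurableSet_safe_at hsafe _)]
  simp

/-- The time-0 term is independent of the policy and is kept exactly; only the other T terms are
bounded below by the probability of staying safe throughout. -/
theorem add_mul_safeProb_le (M : MDP S A) (p : Policy S A) {safe : Set S}
    (hsafe : MeasurableSet safe) :
    M.init.real safe + M.horizon * M.safeProb safe p ≤
      ((M.horizon : ℝ) + 1) * M.cumSafe safe p := by
  rw [succ_mul_cumSafe M p hsafe, Finset.sum_range_succ', law_real_safe_zero M p hsafe, add_comm]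
  gcongr
  simpa using Finset.card_nsmul_le_sum (Finset.range M.horizon)
    (fun t => (M.law p).real {w | (w (t + 1)).1 ∈ safe}) (M.safeProb safe p)
    fun t ht => M.safeProb_le_law_real safe p (by simpa using ht)

/-- Keeping the time-0 term exact here too lets it cancel in the final estimate. -/
theorem succ_mul_cumSafe_le (M : MDP S A) (p : Policy S A) {safe : Set S}
    (hsafe : MeasurableSet safe) :
    ((M.horizon : ℝ) + 1) * M.cumSafe safe p ≤ M.init.real safe + M.horizon := by
  rw [succ_mul_cumSafe M p hsafe, Finset.sum_range_succ', law_real_safe_zero M p hsafe, add_comm]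
  gcongr
  simpa using Finset.sum_le_card_nsmul (Finset.range M.horizon)
    (fun t => (M.law p).real {w | (w (t + 1)).1 ∈ safe}) 1 fun t _ => measureReal_le_one

variable {d : ℕ} (M : MDP S A) {safe : Set S} {δ : ℝ}
  (pol : EuclideanSpace ℝ (Fin d) → Policy S A)

/-- Weak duality. -/
theorem primalOpt_le_dualOpt : M.primalOpt safe δ pol ≤ M.dualOpt safe δ pol := by
  refine le_iInf₂ fun lam hlam => iSup₂_le fun θ hθ => ?_
  refine le_trans ?_ (le_iSup _ θ)
  have : 0 ≤ lam * (M.safeProb safe (pol θ) - (1 - δ)) :=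
    mul_nonneg hlam (sub_nonneg.2 hθ)
  exact_mod_cast le_add_of_nonneg_right this

/-- Scaling a multiplier of the cumulative-constrained problem by `T / (T + 1)` gives a multiplier
of the probabilistic-constrained problem with comparable Lagrangian. -/
theorem lagrangian_scaled_le (hsafe : MeasurableSet safe) {lam : ℝ} (hlam : 0 ≤ lam)
    (θ : EuclideanSpace ℝ (Fin d)) :
    M.value (pol θ) + lam * ((M.horizon : ℝ) / ((M.horizon : ℝ) + 1)) *
        (M.safeProb safe (pol θ) - (1 - δ)) ≤
      M.cumLagrangian safe δ pol lam θ +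
        lam * ((1 - M.init.real safe - δ + M.horizon * δ) / ((M.horizon : ℝ) + 1)) := by
  have hT : (0 : ℝ) < (M.horizon : ℝ) + 1 := by positivity
  have h := M.add_mul_safeProb_le (pol θ) hsafe
  have key : (M.horizon : ℝ) / ((M.horizon : ℝ) + 1) * (M.safeProb safe (pol θ) - (1 - δ)) ≤
      M.cumSafe safe (pol θ) - (1 - δ / ((M.horizon : ℝ) + 1)) +
        (1 - M.init.real safe - δ + M.horizon * δ) / ((M.horizon : ℝ) + 1) := by
    rw [← sub_nonneg]
    have : M.cumSafe safe (pol θ) - (1 - δ / ((M.horizon : ℝ) + 1)) +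
        (1 - M.init.real safe - δ + M.horizon * δ) / ((M.horizon : ℝ) + 1) -
        (M.horizon : ℝ) / ((M.horizon : ℝ) + 1) * (M.safeProb safe (pol θ) - (1 - δ)) =
        (((M.horizon : ℝ) + 1) * M.cumSafe safe (pol θ) -
          (M.init.real safe + M.horizon * M.safeProb safe (pol θ))) / ((M.horizon : ℝ) + 1) := by
      field_simp
      ring
    rw [this]
    exact div_nonneg (sub_nonneg.2 h) hT.le
  have := mul_le_mul_of_nonneg_left key hlam
  unfold cumLagrangian
  linarith

/-- A policy maximizing the Lagrangian for a multiplier slightly above a minimizer of the dual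
function is feasible, and nearly attains the dual optimum. -/
theorem exists_feasible_cumLagrangian_le (hsafe : MeasurableSet safe) {lam ε : ℝ}
    (hlam : 0 ≤ lam) (hε : 0 < ε) {θ₀ θ₁ : EuclideanSpace ℝ (Fin d)}
    (h₀ : ∀ θ, M.cumLagrangian safe δ pol lam θ ≤ M.cumLagrangian safe δ pol lam θ₀)
    (h₁ : M.cumLagrangian safe δ pol lam θ₀ ≤ M.cumLagrangian safe δ pol (lam + ε) θ₁) :
    1 - δ ≤ M.safeProb safe (pol θ₁) ∧
      M.cumLagrangian safe δ pol lam θ₀ - (lam + ε) *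
        ((M.init.real safe - 1 + δ) / ((M.horizon : ℝ) + 1)) ≤ M.value (pol θ₁) := by
  have hT : (0 : ℝ) < (M.horizon : ℝ) + 1 := by positivity
  have hc : M.cumSafe safe (pol θ₁) - (1 - δ / ((M.horizon : ℝ) + 1)) =
      (((M.horizon : ℝ) + 1) * M.cumSafe safe (pol θ₁) - ((M.horizon : ℝ) + 1 - δ)) /
        ((M.horizon : ℝ) + 1) := by
    field_simp
  constructor
  -- From `lam` to `lam + ε` the Lagrangian at `θ₁` changes by `ε` times the constraint slack; `h`
  -- forces this change to be nonnegative.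
  · have h := (h₀ θ₁).trans h₁
    simp only [cumLagrangian] at h
    have hs : 0 ≤ M.cumSafe safe (pol θ₁) - (1 - δ / ((M.horizon : ℝ) + 1)) := by
      refine nonneg_of_mul_nonneg_right (a := ε) ?_ hε
      linarith
    rw [hc, le_div_iff₀ hT] at hs
    have := M.one_sub_safeProb_le (pol θ₁) hsafe
    linarith
  · have hs : M.cumSafe safe (pol θ₁) - (1 - δ / ((M.horizon : ℝ) + 1)) ≤
        (M.init.real safe - 1 + δ) / ((M.horizon : ℝ) + 1) := by
      rw [hc]
      gcongr
      linarith [M.succ_mul_cumSafe_le (pol θ₁) hsafe]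
    have := mul_le_mul_of_nonneg_left hs (add_nonneg hlam hε.le)
    refine (sub_le_sub_right h₁ _).trans ?_
    unfold cumLagrangian
    linarith

theorem cumDualFun_eq {lam : ℝ} {θ₀ : EuclideanSpace ℝ (Fin d)}
    (h₀ : ∀ θ, M.cumLagrangian safe δ pol lam θ ≤ M.cumLagrangian safe δ pol lam θ₀) :
    M.cumDualFun safe δ pol lam = (M.cumLagrangian safe δ pol lam θ₀ : EReal) :=
  le_antisymm (iSup_le fun θ => EReal.coe_le_coe_iff.2 (h₀ θ))
    (le_iSup (fun θ => (M.cumLagrangian safe δ pol lam θ : EReal)) θ₀)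

end SafeRL.MDP

theorem corollary1 {S A : Type*} [MeasurableSpace S] [MeasurableSpace A]
    (M : SafeRL.MDP S A)
    (safe : Set S) (hsafe : MeasurableSet safe)
    (δ : ℝ) (hδ : δ ∈ Set.Icc (0 : ℝ) 1)
    {d : ℕ} (pol : EuclideanSpace ℝ (Fin d) → SafeRL.Policy S A)
    -- universal parametrization: every stochastic kernel is some `pol θ`
    (huniv : ∀ p : SafeRL.Policy S A, ∃ θ, pol θ = p)
    -- the value of every policy is well defined
    (hint : ∀ θ, MeasureTheory.Integrable M.totalReward (M.law (pol θ)))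
    -- the maximum in the dual function of the cumulative-constrained problem is attained
    (hmax : ∀ lam : ℝ, 0 ≤ lam →
      ∃ θ, ∀ θ', M.cumLagrangian safe δ pol lam θ' ≤ M.cumLagrangian safe δ pol lam θ)
    -- `lamHat` minimizes the dual function of the cumulative-constrained problem over `λ ≥ 0`
    (lamHat : ℝ) (hlam : 0 ≤ lamHat)
    (hmin : IsMinOn (M.cumDualFun safe δ pol) (Set.Ici 0) lamHat) :
    M.primalOpt safe δ pol ≤ M.dualOpt safe δ pol ∧
      M.dualOpt safe δ pol ≤ M.primalOpt safe δ pol +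
        ((lamHat * δ * ((M.horizon : ℝ) / ((M.horizon : ℝ) + 1)) : ℝ) : EReal) := by
  refine ⟨M.primalOpt_le_dualOpt pol, ?_⟩
  obtain ⟨θ₀, h₀⟩ := hmax lamHat hlam
  set T : ℝ := (M.horizon : ℝ)
  have hT0 : 0 ≤ T := Nat.cast_nonneg _
  have hT : 0 < T + 1 := by positivity
  set k : ℝ := (M.init.real safe - 1 + δ) / (T + 1) with hk
  set L : ℝ := M.cumLagrangian safe δ pol lamHat θ₀
  have hprimal : ((L - lamHat * k : ℝ) : EReal) ≤ M.primalOpt safe δ pol := by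
    -- A maximizer at `lamHat` itself need not be feasible. Moving to `lamHat + ε`, which is
    -- admissible even if `lamHat = 0`, secures feasibility, and the loss vanishes as ε → 0.
    have hstep : ∀ ε : ℝ, 0 < ε →
        ((L - (lamHat + ε) * k : ℝ) : EReal) ≤ M.primalOpt safe δ pol := by
      intro ε hε
      obtain ⟨θ₁, h₁⟩ := hmax (lamHat + ε) (by positivity)
      have hle := hmin (show lamHat + ε ∈ Set.Ici (0 : ℝ) from add_nonneg hlam hε.le)
      rw [Set.mem_ofPred_eq, M.cumDualFun_eq pol h₀, M.cumDualFun_eq pol h₁,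
        EReal.coe_le_coe_iff] at hle
      obtain ⟨hfeas, hval⟩ := M.exists_feasible_cumLagrangian_le pol hsafe hlam hε h₀ hle
      exact (EReal.coe_le_coe_iff.2 hval).trans
        (le_iSup₂ (f := fun θ (_ : θ ∈ {θ | 1 - δ ≤ M.safeProb safe (pol θ)}) =>
          (M.value (pol θ) : EReal)) θ₁ hfeas)
    have hlim : Filter.Tendsto (fun ε : ℝ => ((L - (lamHat + ε) * k : ℝ) : EReal))
        (nhdsWithin 0 (Set.Ioi 0)) (nhds ((L - (lamHat + 0) * k : ℝ) : EReal)) := by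
      refine ((continuous_coe_real_ereal.comp ?_).tendsto 0).mono_left nhdsWithin_le_nhds
      fun_prop
    rw [add_zero] at hlim
    exact le_of_tendsto hlim (eventually_nhdsWithin_of_forall hstep)
  have hdual : M.dualOpt safe δ pol ≤
      ((L + lamHat * ((1 - M.init.real safe - δ + T * δ) / (T + 1)) : ℝ) : EReal) := by
    refine (iInf₂_le (lamHat * (T / (T + 1)))
      (show (0 : ℝ) ≤ _ by positivity)).trans (iSup_le fun θ => EReal.coe_le_coe_iff.2 ?_)
    exact (M.lagrangian_scaled_le pol hsafe hlam θ).trans (by gcongr; exact h₀ θ)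
  calc M.dualOpt safe δ pol
      ≤ ((L - lamHat * k + lamHat * δ * (T / (T + 1)) : ℝ) : EReal) := by
        -- The term 1 - m - δ in the dual bound is exactly -(T+1) `k`, so only the T δ part
        -- survives.
        refine hdual.trans (EReal.coe_le_coe_iff.2 (le_of_eq ?_))
        rw [hk]
        field_simp
        ring
    _ ≤ _ := by
        rw [EReal.coe_add]
        gcongr
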